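/- **Setting.** Let $X$ be a real separable Hilbert space with orthonormal basis $(\varphi_k)_{k\ge 1}$, let $d>0$, and let $(\alpha_k)_{k\ge1}$ be a positive non-decreasing sequence with $C_-k^{2/d}\le\alpha_k\le C_+k^{2/d}$ for all $k$, where $C_->0$ and $C_+$ are constants. Let $A$ be the self-adjoint operator with $A\varphi_k=\alpha_k\varphi_k$, so that $e^{-A}x=\sum_k e^{-\alpha_k}\langle x,\varphi_k\rangle\varphi_k$, and $A^{-s}x=\sum_k\alpha_k^{-s}\langle x,\varphi_k\rangle\varphi_k$ for $s>0$. Let $b,r>0$ and $\beta,\tau>d/2$. Let $\mu_0=\mathcal N_{r^2A^{-\tau}}$ be the centered Gaussian measure on $X$ with covariance operator $r^2A^{-\tau}$, and let $\nu=\mathcal L_{b^2A^{-\beta}}$ be the centered Laplacian measure, i.e. the distribution of $\sum_k\xi_k\varphi_k$ with independent real random variables $\xi_k$, where $\xi_k$ has the Laplace distribution with mean $0$ and variance $b^2\alpha_k^{-\beta}$. Let $u\sim\mu_0$ and $\eta\sim\nu$ be independent $X$-valued random variables on a common probability space, and let $$y=e^{-A}u+\eta .$$ **Theorem.** For all $x,v\in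 X$ the series $$\Phi(x,v)=\sqrt2\sum_{k=1}^\infty\frac{\bigl|\langle v,\varphi_k\rangle-e^{-\alpha_k}\langle x,\varphi_k\rangle\bigr|-\bigl|\langle v,\varphi_k\rangle\bigr|}{b\,\alpha_k^{-\beta/2}}$$ converges absolutely. For every $v\in X$ the function $x\mapsto\exp(-\Phi(x,v))$ is $\mu_0$-integrable, and there is a constant $C_Z>0$, independent of $v$, such that $$Z(v):=\int_X\exp(-\Phi(x,v))\,\mu_0(\mathrm dx)\ge C_Z\qquad\text{for all }v\in X.$$ Moreover, there exists a regular conditional distribution $(v,B)\mapsto\mu^v(B)$ of $u$ given $y$ such that for **every** $v\in X$ the probability measure $\mu^v$ is absolutely continuous with respect to $\mu_0$ and has the density $$\frac{\mathrm d\mu^v}{\mathrm d\mu_0}(x)=\frac{1}{Z(v)}\exp(-\Phi(x,v)).$$ -/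

import Mathlib

open MeasureTheory ProbabilityTheory Filter Topology
open scoped NNReal ENNReal RealInnerProductSpace

noncomputable section

namespace LaplaceInverse

/-- The Laplace distribution on `ℝ` with mean `a` and variance `v`
(the Dirac mass at `a` in the degenerate case `v = 0`). -/
def laplaceReal (a : ℝ) (v : ℝ≥0) : Measure ℝ :=
  if v = 0 then Measure.dirac a
  else volume.withDensity
    (fun x => ENNReal.ofReal ((√(2 * v))⁻¹ * Real.exp (-(√2 * |x - a| / √v))))

instance isProbabilityMeasure_laplaceReal (a : ℝ) (v : ℝ≥0) :
    IsProbabilityMeasure (laplaceReal a v) := by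
  unfold laplaceReal
  split_ifs with hv
  · infer_instance
  · have hv' : (0 : ℝ) < v := by positivity
    set c : ℝ := √2 / √v with hc
    have hc0 : 0 < c := by positivity
    have hval : ∫ x : ℝ, Real.exp (-c * |x - a|) = 2 / c := by
      rw [integral_sub_right_eq_self (fun x : ℝ => Real.exp (-c * |x|)) a,
        integral_comp_abs (f := fun x => Real.exp (-c * x)),
        integral_exp_mul_Ioi (by linarith) 0]
      simp [div_eq_mul_inv]
    have hint : Integrable (fun x : ℝ => Real.exp (-c * |x - a|)) := by
      by_contra h
      rw [integral_undef h] at hval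
      have : 0 < 2 / c := by positivity
      linarith
    constructor
    rw [withDensity_apply _ MeasurableSet.univ, Measure.restrict_univ]
    have heq : (fun x : ℝ => (√(2 * v))⁻¹ * Real.exp (-(√2 * |x - a| / √v)))
        = fun x => (√(2 * v))⁻¹ * Real.exp (-c * |x - a|) := by
      funext x; congr 2; rw [hc]; ring
    have := ofReal_integral_eq_lintegral_ofReal (hint.const_mul (√(2 * v))⁻¹)
      (ae_of_all _ fun x => by positivity)
    simp_rw [congrFun heq]
    rw [← this, integral_const_mul, hval, hc]
    have : (√(2 * (v : ℝ)))⁻¹ * (2 / (√2 / √v)) = 1 := by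
      rw [Real.sqrt_mul (by norm_num)]
      have h1 : √(v : ℝ) ≠ 0 := by positivity
      have h2 : √(2 : ℝ) * √2 = 2 := Real.mul_self_sqrt (by norm_num)
      field_simp
      linarith
    rw [this]; simp

section Hilbert

variable {X : Type*} [NormedAddCommGroup X] [InnerProductSpace ℝ X]

/-- The operator that is diagonal in the orthonormal basis `e` with diagonal entries `c k`, i.e.
`x ↦ ∑ k, c k ⟪e k, x⟫ e k`. Every operator `f(A)` obtained by functional calculus from
`A e k = α k e k` is of this form with `c k = f (α k)`. -/
def diagOp (e : HilbertBasis ℕ ℝ X) (c : ℕ → ℝ) (x : X) : X :=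
  ∑' k, (c k * ⟪e k, x⟫) • e k

/-- The distribution of `∑ k, ξ k • e k`, where the `ξ k` are independent real random variables
and `ξ k` has distribution `ν k`. -/
def seriesLaw [MeasurableSpace X] (e : HilbertBasis ℕ ℝ X) (ν : ℕ → Measure ℝ) : Measure X :=
  (Measure.infinitePi ν).map (fun z : ℕ → ℝ => ∑' k, z k • e k)

/-- The centered Gaussian measure whose covariance operator has eigensystem `(lam k, e k)`;
see `charFun_gaussianMeasure`. -/
def gaussianMeasure [MeasurableSpace X] (e : HilbertBasis ℕ ℝ X) (lam : ℕ → ℝ≥0) : Measure X :=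
  seriesLaw e (fun k => gaussianReal 0 (lam k))

/-- The centered Laplacian measure whose covariance operator has eigensystem `(lam k, e k)`. -/
def laplaceMeasure [MeasurableSpace X] (e : HilbertBasis ℕ ℝ X) (lam : ℕ → ℝ≥0) : Measure X :=
  seriesLaw e (fun k => laplaceReal 0 (lam k))

/-- The `k`-th term of the series defining the negative log-likelihood. -/
def phiTerm (e : HilbertBasis ℕ ℝ X) (α : ℕ → ℝ) (b β : ℝ) (u y : X) (k : ℕ) : ℝ :=
  (|⟪y, e k⟫ - Real.exp (-α k) * ⟪u, e k⟫| - |⟪y, e k⟫|) / (b * α k ^ (-β / 2))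

/-- The negative log-likelihood `Φ(u, y)`. -/
def phi (e : HilbertBasis ℕ ℝ X) (α : ℕ → ℝ) (b β : ℝ) (u y : X) : ℝ :=
  √2 * ∑' k, phiTerm e α b β u y k

/-! Well-definedness of the measures above. -/

theorem summable_smul_basis_iff [CompleteSpace X] (e : HilbertBasis ℕ ℝ X) (z : ℕ → ℝ) :
    Summable (fun k => z k • e k) ↔ Summable (fun k => z k ^ 2) := by
  have h := e.orthonormal.orthogonalFamily.summable_iff_norm_sq_summable z
  simpa [LinearIsometry.toSpanSingleton_apply] using h

theorem measurable_series [CompleteSpace X] [MeasurableSpace X] [BorelSpace X]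
    (e : HilbertBasis ℕ ℝ X) :
    Measurable (fun z : ℕ → ℝ => ∑' k, z k • e k) := by
  set S : Set (ℕ → ℝ) := {z | Summable (fun k => z k ^ 2)} with hS
  have hSm : MeasurableSet S := by
    have : S = {z : ℕ → ℝ | ∑' k, ENNReal.ofReal (z k ^ 2) ≠ ∞} := by
      ext z
      constructor
      · intro hz; exact hz.tsum_ofReal_ne_top
      · intro hz
        have := ENNReal.summable_toReal hz
        refine this.congr fun k => ?_
        rw [ENNReal.toReal_ofReal (sq_nonneg _)]
    rw [this]
    exact (measurableSet_singleton (∞ : ℝ≥0∞)).compl.preimage (by fun_prop)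
  refine measurable_of_tendsto_metrizable
    (f := fun n => S.indicator (fun z : ℕ → ℝ => ∑ k ∈ Finset.range n, z k • e k)) ?_ ?_
  · intro n
    exact Measurable.indicator (Continuous.measurable (by fun_prop)) hSm
  · rw [tendsto_pi_nhds]
    intro z
    by_cases hz : z ∈ S
    · simpa [Set.indicator_of_mem hz] using
        ((summable_smul_basis_iff e z).2 hz).hasSum.tendsto_sum_nat
    · rw [tsum_eq_zero_of_not_summable (fun h => hz ((summable_smul_basis_iff e z).1 h))]
      simp [Set.indicator_of_notMem hz]

instance isProbabilityMeasure_gaussianMeasure [CompleteSpace X] [MeasurableSpace X] [BorelSpace X]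
    (e : HilbertBasis ℕ ℝ X) (lam : ℕ → ℝ≥0) : IsProbabilityMeasure (gaussianMeasure e lam) :=
  Measure.isProbabilityMeasure_map (measurable_series e).aemeasurable

instance isProbabilityMeasure_laplaceMeasure [CompleteSpace X] [MeasurableSpace X] [BorelSpace X]
    (e : HilbertBasis ℕ ℝ X) (lam : ℕ → ℝ≥0) : IsProbabilityMeasure (laplaceMeasure e lam) :=
  Measure.isProbabilityMeasure_map (measurable_series e).aemeasurable

theorem ae_summable_gaussian (lam : ℕ → ℝ≥0) (hlam : Summable lam) :
    ∀ᵐ z ∂(Measure.infinitePi fun k => gaussianReal 0 (lam k)), Summable (fun k => z k ^ 2) := by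
  have hk : ∀ k, ∫⁻ z : ℕ → ℝ, ENNReal.ofReal (z k ^ 2)
      ∂(Measure.infinitePi fun k => gaussianReal 0 (lam k)) = lam k := by
    intro k
    have h1 := Measure.infinitePi_map_eval (fun k => gaussianReal 0 (lam k)) k
    have h2 : ∫⁻ x, ENNReal.ofReal (x ^ 2) ∂(gaussianReal 0 (lam k)) = lam k := by
      have h3 := variance_fun_id_gaussianReal (μ := 0) (v := lam k)
      rw [variance_eq_integral (by fun_prop)] at h3
      have h4 : Integrable (fun x : ℝ => x ^ 2) (gaussianReal 0 (lam k)) :=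
        (memLp_id_gaussianReal 2).integrable_sq
      rw [← ofReal_integral_eq_lintegral_ofReal h4 (ae_of_all _ fun x => sq_nonneg x)]
      simp only [integral_id_gaussianReal, sub_zero] at h3
      rw [h3]; simp
    rw [← h2, ← h1, lintegral_map (by fun_prop) (by fun_prop)]
  have htot : ∫⁻ z : ℕ → ℝ, ∑' k, ENNReal.ofReal (z k ^ 2)
      ∂(Measure.infinitePi fun k => gaussianReal 0 (lam k)) ≠ ∞ := by
    rw [lintegral_tsum (fun k => Measurable.aemeasurable (by fun_prop))]
    simp_rw [hk]
    exact ENNReal.tsum_coe_ne_top_iff_summable.2 hlam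
  filter_upwards [ae_lt_top (by fun_prop) htot] with z hz
  refine (ENNReal.summable_toReal hz.ne).congr fun k => ?_
  rw [ENNReal.toReal_ofReal (sq_nonneg _)]

/-- `gaussianMeasure e lam` is the Gaussian measure with mean zero and covariance operator
`x ↦ ∑ k, lam k ⟪e k, x⟫ e k`. -/
theorem charFun_gaussianMeasure [CompleteSpace X] [MeasurableSpace X] [BorelSpace X]
    (e : HilbertBasis ℕ ℝ X) (lam : ℕ → ℝ≥0) (hlam : Summable lam) (h : X) :
    charFun (gaussianMeasure e lam) h
      = Complex.exp (-(⟪diagOp e (fun k => lam k) h, h⟫ : ℝ) / 2) := by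
  set Q := Measure.infinitePi fun k => gaussianReal 0 (lam k) with hQ
  have hpart : ∀ n : ℕ, ∫ z : ℕ → ℝ,
      Complex.exp (((∑ k ∈ Finset.range n, z k * ⟪e k, h⟫ : ℝ) : ℂ) * Complex.I) ∂Q
      = Complex.exp (-((∑ k ∈ Finset.range n, lam k * ⟪e k, h⟫ ^ 2 : ℝ) : ℂ) / 2) := by
    intro n
    have hind : iIndepFun (fun (k : ℕ) (z : ℕ → ℝ) => z k * ⟪e k, h⟫) Q :=
      iIndepFun_infinitePi (X := fun k (x : ℝ) => x * ⟪e k, h⟫) (by fun_prop)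
    have h1 := congrFun (iIndepFun.charFun_map_fun_finsetSum_eq_prod
      (X := fun (k : ℕ) (z : ℕ → ℝ) => z k * ⟪e k, h⟫) (P := Q)
      (s := Finset.range n) (fun i _ => Measurable.aemeasurable (by fun_prop))
      (hind.restrict _)) 1
    rw [charFun_apply_real,
      integral_map (Measurable.aemeasurable (by fun_prop)) (by fun_prop)] at h1
    have h2 : ∀ k, charFun (Q.map fun z : ℕ → ℝ => z k * ⟪e k, h⟫) 1
        = Complex.exp (-((lam k * ⟪e k, h⟫ ^ 2 : ℝ) : ℂ) / 2) := by
      intro k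
      have : Q.map (fun z : ℕ → ℝ => z k * ⟪e k, h⟫)
          = (gaussianReal 0 (lam k)).map (fun x => x * ⟪e k, h⟫) := by
        rw [← Measure.infinitePi_map_eval (fun k => gaussianReal 0 (lam k)) k,
          Measure.map_map (by fun_prop) (by fun_prop)]
        rfl
      rw [this, gaussianReal_map_mul_const, charFun_gaussianReal]
      congr 1
      push_cast
      simp
      ring
    rw [Finset.prod_apply, Finset.prod_congr rfl (fun k _ => h2 k), ← Complex.exp_sum] at h1
    simp only [Complex.ofReal_one, one_mul] at h1
    rw [h1]
    congr 1
    push_cast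
    rw [← Finset.sum_div, Finset.sum_neg_distrib]
  have hleft : Tendsto (fun n : ℕ => ∫ z : ℕ → ℝ,
      Complex.exp (((∑ k ∈ Finset.range n, z k * ⟪e k, h⟫ : ℝ) : ℂ) * Complex.I) ∂Q) atTop
      (𝓝 (charFun (gaussianMeasure e lam) h)) := by
    rw [charFun_apply, gaussianMeasure, seriesLaw,
      integral_map (measurable_series e).aemeasurable
        (by exact Continuous.aestronglyMeasurable (by fun_prop))]
    refine tendsto_integral_of_dominated_convergence (fun _ => 1) ?_ (integrable_const _) ?_ ?_
    · intro n
      exact Measurable.aestronglyMeasurable (by fun_prop)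
    · intro n
      exact ae_of_all _ fun z => by rw [Complex.norm_exp_ofReal_mul_I]
    · filter_upwards [ae_summable_gaussian lam hlam] with z hz
      have hs := ((summable_smul_basis_iff e z).2 hz).hasSum.tendsto_sum_nat
      have h3 : Tendsto (fun n => ∑ k ∈ Finset.range n, z k * ⟪e k, h⟫) atTop
          (𝓝 ⟪∑' k, z k • e k, h⟫) := by
        have := (hs.inner (tendsto_const_nhds (x := h)) :
          Tendsto (fun n => ⟪∑ k ∈ Finset.range n, z k • e k, h⟫) atTop _)
        simpa [sum_inner, real_inner_smul_left] using this
      exact (Complex.continuous_exp.tendsto _).comp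
        (((Complex.continuous_ofReal.tendsto _).comp h3).mul_const _)
  have hright : Tendsto (fun n : ℕ =>
      Complex.exp (-((∑ k ∈ Finset.range n, lam k * ⟪e k, h⟫ ^ 2 : ℝ) : ℂ) / 2)) atTop
      (𝓝 (Complex.exp (-(⟪diagOp e (fun k => lam k) h, h⟫ : ℝ) / 2))) := by
    have hsq : Summable (fun k => ((lam k : ℝ) * ⟪e k, h⟫) ^ 2) := by
      have hb : Summable (fun k => ⟪e k, h⟫ ^ 2) := by
        refine (e.summable_inner_mul_inner h h).congr fun k => ?_
        rw [real_inner_comm h (e k), sq]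
      have hl : Tendsto (fun k => (lam k : ℝ) ^ 2) atTop (𝓝 0) := by
        simpa using ((NNReal.summable_coe.2 hlam).tendsto_atTop_zero.pow 2)
      obtain ⟨C, hC⟩ := hl.bddAbove_range
      refine Summable.of_nonneg_of_le (fun k => sq_nonneg _) (fun k => ?_) (hb.mul_left C)
      rw [mul_pow]
      exact mul_le_mul_of_nonneg_right (hC ⟨k, rfl⟩) (sq_nonneg _)
    have hs := ((summable_smul_basis_iff e _).2 hsq).hasSum.tendsto_sum_nat
    have h3 : Tendsto (fun n => ∑ k ∈ Finset.range n, (lam k : ℝ) * ⟪e k, h⟫ ^ 2) atTop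
        (𝓝 ⟪diagOp e (fun k => lam k) h, h⟫) := by
      have := (hs.inner (tendsto_const_nhds (x := h)) :
        Tendsto (fun n => ⟪∑ k ∈ Finset.range n, ((lam k : ℝ) * ⟪e k, h⟫) • e k, h⟫) atTop _)
      simpa [sum_inner, real_inner_smul_left, sq, mul_assoc, diagOp] using this
    exact (Complex.continuous_exp.tendsto _).comp
      (((Complex.continuous_ofReal.tendsto _).comp h3).neg.div_const _)
  exact tendsto_nhds_unique hleft (hright.congr fun n => (hpart n).symm)

end Hilbert

end LaplaceInverse

end

/-!
The posterior is given by Bayes' formula, once the law of the noise shifted by `e^{-A} x` is known to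
have density `v ↦ exp (-Φ(x, v))` with respect to the unshifted law `ν`, for every `x`.

*Shifted noise.* On `ℝ`, the Laplace distribution shifted by `h` has density
`exp (-√2 (|z - h| - |z|) / s)` with respect to the centered one, `s` being the standard deviation.
By the triangle inequality this density is at most `exp (√2 |h| / s)`. Hence, for shifts `h k` with
`∑ |h k| / s k < ∞`, the finite products of the densities are bounded by one constant, and dominated
convergence identifies the infinite product of the shifted laws as the infinite product of the
centered ones with density the infinite product of the densities (`infinitePi_withDensity`). Pushing
this forward along `z ↦ ∑ k, z k • e k` gives `laplaceMeasure_map_add`. The shift `e^{-A} x` is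
admissible because `α k ^ (β / 2) * exp (-α k)` is summable, `α` growing like a power of `k`.

*Bounds.* The same triangle inequality gives `|Φ(x, v)| ≤ c ‖x‖` with `c` independent of `v`
(`exists_abs_phi_le`). As `μ₀` is a Gaussian measure, `exp (c ‖x‖)` is `μ₀`-integrable by Fernique's
theorem, so `exp (-Φ(·, v))` is integrable, and `Z v ≥ ∫ exp (-c ‖x‖) dμ₀ > 0` for all `v`.

*Bayes' formula.* The joint law of `(y, u)` is therefore `exp (-Φ(x, v)) ν(dv) μ₀(dx)`, the law of
`y` is `Z(v) ν(dv)`, and the normalized density defines the conditional distribution for every `v`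
(`hasCondDistrib_of_map_eq_withDensity`).
-/

namespace LaplaceInverse

/-! ### Summability of the weights -/

theorem summable_rpow_neg {α : ℕ → ℝ} {d c s : ℝ} (hd : 0 < d) (hc : 0 < c)
    (hα : ∀ k : ℕ, c * ((k : ℝ) + 1) ^ (2 / d) ≤ α k) (hs : d / 2 < s) :
    Summable fun k => α k ^ (-s) := by
  have hs0 : 0 < s := by linarith
  have hpos : ∀ k : ℕ, 0 < c * ((k : ℝ) + 1) ^ (2 / d) := fun k => by positivity
  have hexp : -(2 * s / d) < -1 := by
    rw [neg_lt_neg_iff, lt_div_iff₀ hd]; linarith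
  have h1 : Summable fun k : ℕ => ((k : ℝ) + 1) ^ (-(2 * s / d)) := by
    have := (summable_nat_add_iff 1).2 (Real.summable_nat_rpow.2 hexp)
    simpa using this
  refine Summable.of_nonneg_of_le (fun k => Real.rpow_nonneg ((hpos k).le.trans (hα k)) _)
    (fun k => ?_) (h1.mul_left (c ^ (-s)))
  calc α k ^ (-s) ≤ (c * ((k : ℝ) + 1) ^ (2 / d)) ^ (-s) :=
        Real.rpow_le_rpow_of_nonpos (hpos k) (hα k) (by linarith)
    _ = c ^ (-s) * ((k : ℝ) + 1) ^ (-(2 * s / d)) := by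
        rw [Real.mul_rpow hc.le (by positivity), ← Real.rpow_mul (by positivity)]
        congr 2; ring

/-- Exponential decay in `α k` beats every power, so only polynomial growth of `α` is needed. -/
theorem summable_rpow_mul_exp_neg {α : ℕ → ℝ} {d c : ℝ} (hd : 0 < d) (hc : 0 < c)
    (hα : ∀ k : ℕ, c * ((k : ℝ) + 1) ^ (2 / d) ≤ α k) (p : ℝ) :
    Summable fun k => α k ^ p * Real.exp (-α k) := by
  have hpos : ∀ k, 0 < α k := fun k => lt_of_lt_of_le (by positivity) (hα k)
  have hlim : Tendsto α atTop atTop := by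
    refine tendsto_atTop_mono hα (Tendsto.const_mul_atTop hc ?_)
    exact (tendsto_rpow_atTop (by positivity)).comp
      (tendsto_atTop_add_const_right _ _ tendsto_natCast_atTop_atTop)
  -- The exponent `-d - p` makes the terms `O(α k ^ (-d))`, which is summable since `d > d / 2`.
  have h1 := ((isLittleO_exp_neg_mul_rpow_atTop one_pos (-d - p)).comp_tendsto hlim).isBigO
  refine summable_of_isBigO_nat (summable_rpow_neg hd hc hα (by linarith : d / 2 < d)) ?_
  refine ((Asymptotics.isBigO_refl (fun k => α k ^ p) atTop).mul h1).congr
    (fun k => by simp) (fun k => ?_)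
  simp only [Function.comp]
  rw [← Real.rpow_add (hpos k)]; congr 1; ring

/-! ### The Laplace distribution on the line -/

theorem laplaceReal_map_add {v : ℝ≥0} (hv : v ≠ 0) (h : ℝ) :
    (laplaceReal 0 v).map (fun x => x + h) = (laplaceReal 0 v).withDensity
      (fun x => ENNReal.ofReal (Real.exp (-(√2 * ((|x - h| - |x|) / √v))))) := by
  ext s hs
  simp only [laplaceReal, hv, if_false, sub_zero]
  rw [← withDensity_mul _ (by fun_prop) (by fun_prop), withDensity_apply _ hs,
    Measure.map_apply (by fun_prop) hs,
    withDensity_apply _ (hs.preimage (by fun_prop)), ← lintegral_indicator hs,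
    ← lintegral_indicator (hs.preimage (by fun_prop)),
    ← lintegral_add_right_eq_self (fun x => s.indicator _ x) h]
  refine lintegral_congr fun x => ?_
  by_cases hx : x + h ∈ s
  · rw [Set.indicator_of_mem hx, Set.indicator_of_mem (by exact hx), Pi.mul_apply,
      ← ENNReal.ofReal_mul (by positivity), mul_assoc, ← Real.exp_add]
    congr 3
    rw [add_sub_cancel_right]
    ring
  · rw [Set.indicator_of_notMem hx, Set.indicator_of_notMem (by exact hx)]

theorem lintegral_sq_laplaceReal {v : ℝ≥0} (hv : v ≠ 0) :
    ∫⁻ x, ENNReal.ofReal (x ^ 2) ∂(laplaceReal 0 v) = v := by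
  have hv' : (0 : ℝ) < v := by positivity
  set c : ℝ := √2 / √v with hc
  have hc0 : 0 < c := by positivity
  have hval : ∫ x : ℝ, x ^ 2 * Real.exp (-(c * |x|)) = 4 / c ^ 3 := by
    have h1 := integral_comp_abs (f := fun x => x ^ 2 * Real.exp (-(c * x)))
    simp only [sq_abs] at h1
    rw [h1]
    have h2 := Real.integral_rpow_mul_exp_neg_mul_Ioi (a := 3) (by norm_num) hc0
    have h3 : Real.Gamma 3 = 2 := by
      rw [Real.Gamma_ofNat_eq_factorial]; norm_num [Nat.factorial]
    rw [h3] at h2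
    norm_num at h2
    rw [h2]
    field_simp
    norm_num
  have hint : Integrable (fun x : ℝ => x ^ 2 * Real.exp (-(c * |x|))) := by
    -- A Bochner integral with a nonzero value has an integrable integrand.
    by_contra h
    rw [integral_undef h] at hval
    have : 0 < 4 / c ^ 3 := by positivity
    linarith
  simp only [laplaceReal, hv, if_false, sub_zero]
  rw [lintegral_withDensity_eq_lintegral_mul _ (by fun_prop) (by fun_prop)]
  have heq : ∀ x : ℝ, ((fun x : ℝ => ENNReal.ofReal ((√(2 * v))⁻¹ * Real.exp (-(√2 * |x| / √v))))
      * fun x : ℝ => ENNReal.ofReal (x ^ 2)) x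
      = ENNReal.ofReal ((√(2 * v))⁻¹ * (x ^ 2 * Real.exp (-(c * |x|)))) := by
    intro x
    rw [Pi.mul_apply, ← ENNReal.ofReal_mul (by positivity)]
    congr 1
    rw [hc, mul_div_right_comm √2 |x| √v]; ring
  simp_rw [heq]
  rw [← ofReal_integral_eq_lintegral_ofReal (hint.const_mul _)
    (ae_of_all _ fun x => by positivity), integral_const_mul, hval, hc]
  have : (√(2 * (v : ℝ)))⁻¹ * (4 / (√2 / √v) ^ 3) = v := by
    rw [Real.sqrt_mul (by norm_num)]
    have h1 : √(v : ℝ) ≠ 0 := by positivity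
    have h2 : √(2 : ℝ) ^ 4 = 4 := by
      rw [show (4 : ℕ) = 2 * 2 from rfl, pow_mul, Real.sq_sqrt (by norm_num)]; norm_num
    have h3 : √(v : ℝ) ^ 2 = v := Real.sq_sqrt hv'.le
    field_simp
    rw [h2, h3]; ring
  rw [this]; simp

/-! ### Infinite product measures -/

/-- Under the product of measures with summable second moments, almost every sequence is square
summable, because the expectation of `∑ k, z k ^ 2` is finite. -/
theorem ae_summable_sq_infinitePi {ν : ℕ → Measure ℝ} [∀ k, IsProbabilityMeasure (ν k)]
    {lam : ℕ → ℝ≥0} (hlam : Summable lam)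
    (hν : ∀ k, ∫⁻ x, ENNReal.ofReal (x ^ 2) ∂(ν k) ≤ lam k) :
    ∀ᵐ z ∂(Measure.infinitePi ν), Summable (fun k => z k ^ 2) := by
  have htot : ∫⁻ z : ℕ → ℝ, ∑' k, ENNReal.ofReal (z k ^ 2) ∂(Measure.infinitePi ν) ≠ ∞ := by
    rw [lintegral_tsum (fun k => Measurable.aemeasurable (by fun_prop))]
    refine ne_top_of_le_ne_top (ENNReal.tsum_coe_ne_top_iff_summable.2 hlam)
      (ENNReal.tsum_le_tsum fun k => ?_)
    rw [← lintegral_map (f := fun x : ℝ => ENNReal.ofReal (x ^ 2)) (by fun_prop)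
      (measurable_pi_apply k), Measure.infinitePi_map_eval]
    exact hν k
  filter_upwards [ae_lt_top (by fun_prop) htot] with z hz
  refine (ENNReal.summable_toReal hz.ne).congr fun k => ?_
  rw [ENNReal.toReal_ofReal (sq_nonneg _)]

/-- If each `ν k` has density `ρ k` with respect to `μ k` and the partial products of the densities are
bounded by one constant and converge, then `∏ ν k` has the limit as density with respect to `∏ μ k`.
The uniform bound makes Kakutani's Hellinger-integral criterion unnecessary: on a cylinder set the
partial products integrate to the right mass from some index on, and dominated convergence applies. -/
theorem infinitePi_withDensity {E : ℕ → Type*} [∀ k, MeasurableSpace (E k)]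
    {μ ν : ∀ k, Measure (E k)}
    [∀ k, IsProbabilityMeasure (μ k)] [∀ k, IsProbabilityMeasure (ν k)]
    {ρ : ∀ k, E k → ℝ≥0∞} (hρ : ∀ k, Measurable (ρ k))
    (hν : ∀ k, ν k = (μ k).withDensity (ρ k)) {C : ℝ≥0∞} (hC : C ≠ ∞)
    (hbound : ∀ (n : ℕ) (z : ∀ k, E k), ∏ k ∈ Finset.range n, ρ k (z k) ≤ C) {D : (∀ k, E k) → ℝ≥0∞}
    (hlim : ∀ z, Tendsto (fun n => ∏ k ∈ Finset.range n, ρ k (z k)) atTop (𝓝 (D z))) :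
    Measure.infinitePi ν = (Measure.infinitePi μ).withDensity D := by
  classical
  refine (Measure.eq_infinitePi _ fun s t ht => ?_).symm
  have hmeas : MeasurableSet ((s : Set ℕ).pi t) :=
    .pi s.countable_toSet fun _ _ => ht _
  rw [withDensity_apply _ hmeas]
  have h1 : Tendsto (fun n => ∫⁻ z in (s : Set ℕ).pi t, ∏ k ∈ Finset.range n, ρ k (z k)
      ∂(Measure.infinitePi μ)) atTop
      (𝓝 (∫⁻ z in (s : Set ℕ).pi t, D z ∂(Measure.infinitePi μ))) := by
    refine tendsto_lintegral_of_dominated_convergence (fun _ => C) (fun n => ?_)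
      (fun n => ae_of_all _ fun z => hbound n z) ?_ (ae_of_all _ hlim)
    · exact Finset.measurable_fun_prod _ fun k _ => (hρ k).comp (measurable_pi_apply k)
    · simpa using ENNReal.mul_ne_top hC (measure_ne_top _ _)
  refine tendsto_nhds_unique h1 (tendsto_const_nhds.congr' ?_)
  obtain ⟨N, hN⟩ := s.exists_nat_subset_range
  filter_upwards [eventually_ge_atTop N] with n hn
  have hsn : s ⊆ Finset.range n := hN.trans (Finset.range_mono hn)
  -- Coordinates outside `s` are unconstrained.
  set A : ∀ k, Set (E k) := fun k => if k ∈ s then t k else Set.univ with hA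
  have hAm : ∀ k, MeasurableSet (A k) := fun k => by
    by_cases hk : k ∈ s <;> simp [hA, hk, ht k]
  have hind : iIndepFun (fun (k : ℕ) (z : ∀ k, E k) => (A k).indicator (ρ k) (z k))
      (Measure.infinitePi μ) :=
    iIndepFun_infinitePi (X := fun k x => (A k).indicator (ρ k) x)
      fun k => (hρ k).indicator (hAm k)
  have h2 := lintegral_prod_eq_prod_lintegral_of_indepFun (Finset.range n) _ hind
    fun k => ((hρ k).indicator (hAm k)).comp (measurable_pi_apply k)
  have h3 : ∀ k, ∫⁻ z, (A k).indicator (ρ k) (z k) ∂(Measure.infinitePi μ) = ν k (A k) := by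
    intro k
    rw [← lintegral_map (f := (A k).indicator (ρ k)) ((hρ k).indicator (hAm k))
      (measurable_pi_apply k), Measure.infinitePi_map_eval, lintegral_indicator (hAm k),
      hν k, withDensity_apply _ (hAm k)]
  simp_rw [h3] at h2
  rw [← lintegral_indicator hmeas]
  calc ∏ i ∈ s, ν i (t i) = ∏ k ∈ Finset.range n, ν k (A k) := by
        rw [← Finset.prod_subset hsn fun k _ hk => by simp [hA, hk]]
        exact Finset.prod_congr rfl fun k hk => by simp [hA, hk]
    _ = _ := by
        rw [← h2]
        refine lintegral_congr fun z => ?_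
        by_cases hz : z ∈ (s : Set ℕ).pi t
        · rw [Set.indicator_of_mem hz]
          refine Finset.prod_congr rfl fun k _ => Set.indicator_of_mem ?_ _
          by_cases hk : k ∈ s
          · simpa [hA, hk] using hz k hk
          · simp [hA, hk]
        · rw [Set.indicator_of_notMem hz]
          simp only [Set.mem_pi, not_forall] at hz
          obtain ⟨k, hk, hzk⟩ := hz
          refine Finset.prod_eq_zero (hsn hk) (Set.indicator_of_notMem ?_ _)
          have : k ∈ s := hk
          simpa [hA, this] using hzk

section Hilbert

variable {X : Type*} [NormedAddCommGroup X] [InnerProductSpace ℝ X]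

/-! ### Expansions in a Hilbert basis -/

theorem secondCountableTopology_of_hilbertBasis (e : HilbertBasis ℕ ℝ X) :
    SecondCountableTopology X := by
  have h : TopologicalSpace.IsSeparable (Set.univ : Set X) := by
    have := (((Set.countable_range e).isSeparable).span (R := ℝ)).closure
    rwa [← Submodule.topologicalClosure_coe, e.dense_span] at this
  have := TopologicalSpace.isSeparable_univ_iff.1 h
  exact UniformSpace.secondCountable_of_separable X

theorem inner_tsum_smul_basis [CompleteSpace X] (e : HilbertBasis ℕ ℝ X) {z : ℕ → ℝ}
    (hz : Summable fun k => z k ^ 2) (j : ℕ) : ⟪e j, ∑' k, z k • e k⟫ = z j := by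
  classical
  have h := (innerSL ℝ (e j)).map_tsum ((summable_smul_basis_iff e z).2 hz)
  simp only [innerSL_apply_apply] at h
  rw [h, tsum_eq_single j fun k hk => by
    rw [real_inner_smul_right, e.orthonormal.2 hk.symm, mul_zero]]
  rw [real_inner_smul_right, real_inner_self_eq_norm_sq, e.orthonormal.1]; simp

theorem summable_inner_sq (e : HilbertBasis ℕ ℝ X) (x : X) : Summable fun k => ⟪e k, x⟫ ^ 2 := by
  refine (e.summable_inner_mul_inner x x).congr fun k => ?_
  rw [real_inner_comm x (e k), sq]

/-! ### Shifts of the centered Laplacian measure -/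

/-- Measurability of series of the form of `phi`, in both arguments jointly or in one of them. -/
theorem measurable_tsum_abs_sub [MeasurableSpace X] [BorelSpace X] (e : HilbertBasis ℕ ℝ X)
    {Y : Type*} [MeasurableSpace Y] {f : Y → X} (hf : Measurable f) {g : ℕ → Y → ℝ}
    (hg : ∀ k, Measurable (g k)) (s : ℕ → ℝ) :
    Measurable fun y => ∑' k, (|⟪f y, e k⟫ - g k y| - |⟪f y, e k⟫|) / s k := by
  refine Measurable.tsum fun k => ?_
  have h : Measurable fun y => ⟪f y, e k⟫ :=
    (show Continuous fun x : X => ⟪x, e k⟫ by fun_prop).measurable.comp hf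
  exact (((h.sub (hg k)).abs).sub h.abs).div_const _

theorem abs_abs_sub_sub_abs_div_le (a h : ℝ) {s : ℝ} (hs : 0 ≤ s) :
    |(|a - h| - |a|) / s| ≤ |h| / s := by
  rw [abs_div, abs_of_nonneg hs]
  refine div_le_div_of_nonneg_right ?_ hs
  have h1 := abs_abs_sub_abs_le_abs_sub (a - h) a
  rwa [sub_sub_cancel_left, abs_neg] at h1

/-- The law of the Laplacian measure shifted by `h` has a density with respect to the unshifted law as
soon as the coordinates of `h`, measured in standard deviations, are absolutely summable. -/
theorem laplaceMeasure_map_add [CompleteSpace X] [MeasurableSpace X] [BorelSpace X]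
    (e : HilbertBasis ℕ ℝ X) {lam : ℕ → ℝ≥0} (hlam0 : ∀ k, lam k ≠ 0) (hlam : Summable lam)
    (h : X) (hh : Summable fun k => |⟪e k, h⟫| / √(lam k)) :
    (laplaceMeasure e lam).map (fun v => h + v) = (laplaceMeasure e lam).withDensity
      (fun v => ENNReal.ofReal (Real.exp
        (-(√2 * ∑' k, (|⟪v, e k⟫ - ⟪e k, h⟫| - |⟪v, e k⟫|) / √(lam k))))) := by
  set Q := Measure.infinitePi fun k => laplaceReal 0 (lam k) with hQ
  set S : (ℕ → ℝ) → X := fun z => ∑' k, z k • e k with hS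
  set c : ℕ → ℝ := fun k => ⟪e k, h⟫ with hc
  have hSm : Measurable S := measurable_series e
  have hae : ∀ᵐ z ∂Q, Summable fun k => z k ^ 2 :=
    ae_summable_sq_infinitePi hlam fun k => (lintegral_sq_laplaceReal (hlam0 k)).le
  have hD : Measurable fun v : X => ENNReal.ofReal (Real.exp
      (-(√2 * ∑' k, (|⟪v, e k⟫ - c k| - |⟪v, e k⟫|) / √(lam k)))) :=
    (Real.measurable_exp.comp
      ((measurable_tsum_abs_sub e measurable_id (fun k => measurable_const) _).const_mul
        _).neg).ennreal_ofReal
  have hSh : S c = h := by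
    have := (e.hasSum_repr h).tsum_eq
    simpa only [hS, hc, e.repr_apply_apply] using this
  have hshift : Q.map (fun z => z + c) = Q.withDensity (fun z => ENNReal.ofReal (Real.exp
      (-(√2 * ∑' k, (|z k - c k| - |z k|) / √(lam k))))) := by
    have h1 := Measure.infinitePi_map_pi (fun k => laplaceReal 0 (lam k))
      (f := fun k x => x + c k) (fun k => by fun_prop)
    have hprob : ∀ k, IsProbabilityMeasure ((laplaceReal 0 (lam k)).map (fun x => x + c k)) :=
      fun k => Measure.isProbabilityMeasure_map (by fun_prop)
    have hprod : ∀ (n : ℕ) (z : ℕ → ℝ), ∏ k ∈ Finset.range n, ENNReal.ofReal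
        (Real.exp (-(√2 * ((|z k - c k| - |z k|) / √(lam k))))) = ENNReal.ofReal
        (Real.exp (-(√2 * ∑ k ∈ Finset.range n, (|z k - c k| - |z k|) / √(lam k)))) := by
      intro n z
      rw [← ENNReal.ofReal_prod_of_nonneg fun _ _ => (Real.exp_pos _).le, ← Real.exp_sum,
        Finset.sum_neg_distrib, Finset.mul_sum]
    -- The shift acts coordinatewise, so it maps a product measure to a product measure.
    change Q.map (fun z k => z k + c k) = _
    rw [hQ, h1]
    refine infinitePi_withDensity
      (ρ := fun k x => ENNReal.ofReal (Real.exp (-(√2 * ((|x - c k| - |x|) / √(lam k))))))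
      (C := ENNReal.ofReal (Real.exp (√2 * ∑' k, |c k| / √(lam k))))
      (fun k => by fun_prop) (fun k => laplaceReal_map_add (hlam0 k) _) ENNReal.ofReal_ne_top
      (fun n z => ?_) (fun z => ?_)
    · rw [hprod, neg_mul_eq_mul_neg]
      gcongr
      refine le_trans ((neg_le_abs _).trans (Finset.abs_sum_le_sum_abs _ _)) ?_
      refine (Finset.sum_le_sum fun k _ =>
        abs_abs_sub_sub_abs_div_le (z k) (c k) (Real.sqrt_nonneg _)).trans ?_
      exact hh.sum_le_tsum _ fun k _ => by positivity
    · simp_rw [hprod]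
      have hs : Summable fun k => (|z k - c k| - |z k|) / √(lam k) :=
        Summable.of_norm_bounded hh fun k =>
          abs_abs_sub_sub_abs_div_le (z k) (c k) (Real.sqrt_nonneg _)
      exact (ENNReal.continuous_ofReal.tendsto _).comp ((Real.continuous_exp.tendsto _).comp
        ((hs.hasSum.tendsto_sum_nat.const_mul _).neg))
  calc (laplaceMeasure e lam).map (fun v => h + v)
      = Q.map (fun z => h + S z) := Measure.map_map (by fun_prop) hSm
    -- `S` is additive only on square summable sequences, hence the almost sure identity.
    _ = Q.map (fun z => S (z + c)) := by
        refine Measure.map_congr ?_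
        filter_upwards [hae] with z hz
        have h1 := (summable_smul_basis_iff e z).2 hz
        have h2 := (summable_smul_basis_iff e c).2 (summable_inner_sq e h)
        rw [← hSh]
        simp only [hS, Pi.add_apply, add_smul]
        rw [h1.tsum_add h2, add_comm]
    _ = (Q.map (fun z => z + c)).map S := (Measure.map_map hSm (by fun_prop)).symm
    _ = _ := by
        rw [hshift]
        ext s hs
        rw [Measure.map_apply hSm hs, withDensity_apply _ (hSm hs), withDensity_apply _ hs]
        change _ = ∫⁻ v in s, _ ∂(Q.map S)
        rw [setLIntegral_map hs hD hSm]
        -- Almost surely the coordinates of `S z` are those of `z`.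
        refine lintegral_congr_ae (ae_restrict_of_ae ?_)
        filter_upwards [hae] with z hz
        simp only [hS, real_inner_comm _ (∑' k, z k • e k), inner_tsum_smul_basis e hz]

/-! ### Exponential moments of Gaussian measures -/

theorem diagOp_smul [CompleteSpace X] (e : HilbertBasis ℕ ℝ X) (c : ℕ → ℝ) (s : ℝ) (x : X) :
    diagOp e c (s • x) = s • diagOp e c x := by
  simp only [diagOp]
  rw [← tsum_const_smul'']
  refine tsum_congr fun k => ?_
  rw [real_inner_smul_right, smul_smul]
  congr 1; ring

/-- Every one-dimensional projection has the characteristic function of a centered normal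
distribution, by `charFun_gaussianMeasure`. -/
theorem isGaussian_gaussianMeasure [CompleteSpace X] [MeasurableSpace X] [BorelSpace X]
    (e : HilbertBasis ℕ ℝ X) (lam : ℕ → ℝ≥0) (hlam : Summable lam) :
    IsGaussian (gaussianMeasure e lam) := by
  refine isGaussian_of_map_eq_gaussianReal fun L => ?_
  obtain ⟨t, rfl⟩ := (InnerProductSpace.toDual ℝ X).surjective L
  set q : ℝ := ⟪diagOp e (fun k => lam k) t, t⟫ with hq
  have hq0 : 0 ≤ q := by
    -- The modulus `exp (-q / 2)` of the characteristic function at `t` is at most one.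
    have h1 := norm_charFun_le_one (μ := gaussianMeasure e lam) t
    rw [charFun_gaussianMeasure e lam hlam, ← hq, Complex.norm_exp, Real.exp_le_one_iff] at h1
    have h2 : (-(q : ℂ) / 2).re = -q / 2 := by
      rw [← Complex.ofReal_neg, Complex.div_ofNat_re, Complex.ofReal_re]
    rw [h2] at h1
    linarith
  refine ⟨0, q.toNNReal, ?_⟩
  have := Measure.isProbabilityMeasure_map (μ := gaussianMeasure e lam)
    (f := InnerProductSpace.toDual ℝ X t) (by fun_prop)
  refine Measure.ext_of_charFun (funext fun s => ?_)
  have h1 : charFun ((gaussianMeasure e lam).map (InnerProductSpace.toDual ℝ X t)) s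
      = charFun (gaussianMeasure e lam) (s • t) := by
    rw [charFun_apply_real, charFun_apply, integral_map (by fun_prop) (by fun_prop)]
    refine integral_congr_ae (ae_of_all _ fun x => ?_)
    simp [real_inner_smul_right, real_inner_comm x t]
  rw [h1, charFun_gaussianMeasure e lam hlam, charFun_gaussianReal, diagOp_smul,
    real_inner_smul_left, real_inner_smul_right, ← hq]
  congr 1
  simp [Real.coe_toNNReal _ hq0]
  ring

/-- A consequence of Fernique's theorem, since `c * ‖x‖` is at most `C * ‖x‖ ^ 2` plus a constant. -/
theorem _root_.ProbabilityTheory.IsGaussian.integrable_exp_mul_norm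
    {E : Type*} [NormedAddCommGroup E] [NormedSpace ℝ E] [CompleteSpace E]
    [SecondCountableTopology E] [MeasurableSpace E] [BorelSpace E] (μ : Measure E) [IsGaussian μ]
    (c : ℝ) : Integrable (fun x => Real.exp (c * ‖x‖)) μ := by
  obtain ⟨C, hC, hint⟩ := IsGaussian.exists_integrable_exp_sq μ
  refine (hint.const_mul (Real.exp (c ^ 2 / (4 * C)))).mono'
    (Continuous.aestronglyMeasurable (by fun_prop)) (ae_of_all _ fun x => ?_)
  rw [Real.norm_of_nonneg (Real.exp_pos _).le, ← Real.exp_add, Real.exp_le_exp]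
  -- Completing the square: `(c / (2 √C) - √C ‖x‖) ^ 2 ≥ 0`.
  have h : c ^ 2 / (4 * C) + C * ‖x‖ ^ 2 - c * ‖x‖ = (c - 2 * C * ‖x‖) ^ 2 / (4 * C) := by
    field_simp; ring
  have : 0 ≤ (c - 2 * C * ‖x‖) ^ 2 / (4 * C) := by positivity
  linarith

/-! ### The negative log-likelihood -/

theorem abs_phiTerm_le (e : HilbertBasis ℕ ℝ X) {α : ℕ → ℝ} (hα : ∀ k, 0 < α k) {b : ℝ}
    (hb : 0 < b) (β : ℝ) (x v : X) (k : ℕ) :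
    |phiTerm e α b β x v k| ≤ b⁻¹ * (α k ^ (β / 2) * Real.exp (-α k)) * ‖x‖ := by
  have hs : 0 ≤ b * α k ^ (-β / 2) := mul_nonneg hb.le (Real.rpow_nonneg (hα k).le _)
  refine (abs_abs_sub_sub_abs_div_le _ _ hs).trans ?_
  have h1 : |⟪x, e k⟫| ≤ ‖x‖ := by
    simpa [e.orthonormal.1 k] using abs_real_inner_le_norm x (e k)
  have h2 : α k ^ (-β / 2) = (α k ^ (β / 2))⁻¹ := by
    rw [neg_div, Real.rpow_neg (hα k).le]
  have h3 : 0 < α k ^ (β / 2) := Real.rpow_pos_of_pos (hα k) _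
  rw [abs_mul, abs_of_pos (Real.exp_pos _), h2]
  calc Real.exp (-α k) * |⟪x, e k⟫| / (b * (α k ^ (β / 2))⁻¹)
      = b⁻¹ * (α k ^ (β / 2) * Real.exp (-α k)) * |⟪x, e k⟫| := by field_simp
    _ ≤ _ := by gcongr

theorem summable_phiTerm (e : HilbertBasis ℕ ℝ X) {α : ℕ → ℝ} (hα : ∀ k, 0 < α k) {b β : ℝ}
    (hb : 0 < b) (hsum : Summable fun k => α k ^ (β / 2) * Real.exp (-α k)) (x v : X) :
    Summable (phiTerm e α b β x v) :=
  Summable.of_norm_bounded ((hsum.mul_left b⁻¹).mul_right ‖x‖)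
    fun k => abs_phiTerm_le e hα hb β x v k

/-- The growth bound on the negative log-likelihood; that the constant does not depend on `v` is what
makes the lower bound on the normalizing constants uniform. -/
theorem exists_abs_phi_le (e : HilbertBasis ℕ ℝ X) {α : ℕ → ℝ} (hα : ∀ k, 0 < α k) {b β : ℝ}
    (hb : 0 < b) (hsum : Summable fun k => α k ^ (β / 2) * Real.exp (-α k)) :
    ∃ c, ∀ x v : X, |phi e α b β x v| ≤ c * ‖x‖ := by
  refine ⟨√2 * ∑' k, b⁻¹ * (α k ^ (β / 2) * Real.exp (-α k)), fun x v => ?_⟩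
  rw [phi, abs_mul, abs_of_nonneg (Real.sqrt_nonneg _), mul_assoc, ← tsum_mul_right]
  gcongr
  exact tsum_of_norm_bounded (f := phiTerm e α b β x v) ((hsum.mul_left b⁻¹).mul_right ‖x‖).hasSum
    fun k => abs_phiTerm_le e hα hb β x v k

theorem measurable_phi [MeasurableSpace X] [BorelSpace X] (e : HilbertBasis ℕ ℝ X) (α : ℕ → ℝ)
    (b β : ℝ) : Measurable fun p : X × X => phi e α b β p.2 p.1 := by
  refine (measurable_tsum_abs_sub e measurable_fst (fun k => ?_) _).const_mul _
  exact ((show Continuous fun x : X => ⟪x, e k⟫ by fun_prop).measurable.comp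
    measurable_snd).const_mul _

theorem measurable_diagOp [CompleteSpace X] [MeasurableSpace X] [BorelSpace X]
    (e : HilbertBasis ℕ ℝ X) (c : ℕ → ℝ) : Measurable (diagOp e c) := by
  refine (measurable_series e).comp (measurable_pi_lambda _ fun k => ?_)
  exact (show Continuous fun x : X => ⟪e k, x⟫ by fun_prop).measurable.const_mul _

theorem inner_diagOp [CompleteSpace X] (e : HilbertBasis ℕ ℝ X) {c : ℕ → ℝ}
    (hc : ∀ k, |c k| ≤ 1) (x : X) (k : ℕ) : ⟪e k, diagOp e c x⟫ = c k * ⟪e k, x⟫ := by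
  refine inner_tsum_smul_basis e ?_ k
  refine Summable.of_nonneg_of_le (fun k => sq_nonneg _) (fun k => ?_) (summable_inner_sq e x)
  rw [mul_pow]
  exact mul_le_of_le_one_left (sq_nonneg _) ((sq_le_one_iff_abs_le_one _).2 (hc k))

/-- The conditional law of the data `e^{-A} x + η` has density `exp (-Φ(x, ·))` with respect to the law
of the noise `η`. -/
theorem laplaceMeasure_map_diagOp_add [CompleteSpace X] [MeasurableSpace X] [BorelSpace X]
    (e : HilbertBasis ℕ ℝ X) {α : ℕ → ℝ} (hα : ∀ k, 0 < α k) {b β : ℝ} (hb : 0 < b)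
    (hlam : Summable fun k => α k ^ (-β))
    (hsum : Summable fun k => α k ^ (β / 2) * Real.exp (-α k)) (x : X) :
    (laplaceMeasure e fun k => (b ^ 2 * α k ^ (-β)).toNNReal).map
        (fun v => diagOp e (fun k => Real.exp (-α k)) x + v)
      = (laplaceMeasure e fun k => (b ^ 2 * α k ^ (-β)).toNNReal).withDensity
        (fun v => ENNReal.ofReal (Real.exp (-phi e α b β x v))) := by
  have hpos : ∀ k, 0 < b ^ 2 * α k ^ (-β) := fun k =>
    mul_pos (by positivity) (Real.rpow_pos_of_pos (hα k) _)
  have hsqrt : ∀ k, √((b ^ 2 * α k ^ (-β)).toNNReal : ℝ) = b * α k ^ (-β / 2) := by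
    intro k
    rw [Real.coe_toNNReal _ (hpos k).le, Real.sqrt_mul (by positivity), Real.sqrt_sq hb.le,
      Real.sqrt_eq_rpow, ← Real.rpow_mul (hα k).le]
    congr 2; ring
  have hinner : ∀ k, ⟪e k, diagOp e (fun k => Real.exp (-α k)) x⟫
      = Real.exp (-α k) * ⟪x, e k⟫ := by
    intro k
    rw [inner_diagOp e (fun k => ?_) x k, real_inner_comm]
    rw [abs_of_pos (Real.exp_pos _), Real.exp_le_one_iff]
    linarith [hα k]
  rw [laplaceMeasure_map_add e (fun k => (Real.toNNReal_pos.2 (hpos k)).ne')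
    ((hlam.mul_left (b ^ 2)).toNNReal)]
  · simp only [hsqrt, hinner]
    rfl
  · simp only [hsqrt, hinner]
    -- The weights are those of `phiTerm` at `v = 0`.
    exact (summable_phiTerm e hα hb hsum x 0).congr fun k => by simp [phiTerm]

end Hilbert

/-! ### Bayes' formula -/

/-- **Bayes' formula** with an additive noise `η ~ ν` independent of `u ~ μ`: if for every `x` the law of
`G x + η` has density `D · x` with respect to `ν`, then the normalized densities `D v · / ∫ D v dμ`
with respect to `μ` form the conditional distribution of `u` given `G u + η`. -/
theorem hasCondDistrib_of_map_eq_withDensity {X Ω : Type*} [MeasurableSpace X] [AddCommGroup X]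
    [MeasurableAdd₂ X] [MeasurableSpace Ω] {P : Measure Ω} {μ ν : Measure X}
    [IsProbabilityMeasure μ] [IsProbabilityMeasure ν] {G : X → X} (hG : Measurable G)
    {D : X → X → ℝ≥0∞} (hD : Measurable (Function.uncurry D))
    (hshift : ∀ x, ν.map (fun v => G x + v) = ν.withDensity fun v => D v x)
    (hZ0 : ∀ v, ∫⁻ x, D v x ∂μ ≠ 0) (hZ : ∀ v, ∫⁻ x, D v x ∂μ ≠ ∞)
    {u η : Ω → X} (hu : HasLaw u μ P) (hη : HasLaw η ν P) (hind : IndepFun u η P)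
    {κ : Kernel X X} [IsSFiniteKernel κ]
    (hκ : ∀ v, κ v = μ.withDensity fun x => D v x / ∫⁻ x', D v x' ∂μ) :
    HasCondDistrib u (fun ω => G (u ω) + η ω) κ P := by
  have hum := hu.aemeasurable
  have hηm := hη.aemeasurable
  have hGm : Measurable fun p : X × X => G p.1 + p.2 := by fun_prop
  have hym : AEMeasurable (fun ω => G (u ω) + η ω) P :=
    hGm.comp_aemeasurable (hum.prodMk hηm)
  -- The joint law of `(y, u)` has density `(v, x) ↦ D v x` with respect to `ν ⊗ μ`.
  have hjoint : ∀ f : X × X → ℝ≥0∞, Measurable f →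
      ∫⁻ p, f p ∂(P.map fun ω => (G (u ω) + η ω, u ω))
        = ∫⁻ v, ∫⁻ x, D v x * f (v, x) ∂μ ∂ν := by
    intro f hf
    have hφ : Measurable fun p : X × X => (G p.1 + p.2, p.1) := hGm.prodMk measurable_fst
    have h1 : P.map (fun ω => (G (u ω) + η ω, u ω))
        = (μ.prod ν).map fun p : X × X => (G p.1 + p.2, p.1) := by
      rw [← hu.map_eq, ← hη.map_eq, ← (indepFun_iff_map_prod_eq_prod_map_map' hum hηm
        (by rw [hu.map_eq]; infer_instance) (by rw [hη.map_eq]; infer_instance)).1 hind,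
        AEMeasurable.map_map_of_aemeasurable hφ.aemeasurable (hum.prodMk hηm)]
      rfl
    rw [h1, lintegral_map hf hφ,
      lintegral_prod (fun p : X × X => f (G p.1 + p.2, p.1)) (hf.comp hφ).aemeasurable,
      lintegral_lintegral_swap (f := fun v x => D v x * f (v, x)) (hD.mul hf).aemeasurable]
    refine lintegral_congr fun x => ?_
    have hfx : Measurable fun v => f (v, x) := by fun_prop
    rw [← lintegral_map (f := fun v => f (v, x)) (g := fun v => G x + v) hfx (by fun_prop),
      hshift x, lintegral_withDensity_eq_lintegral_mul _ (by fun_prop) hfx]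
    rfl
  have hZm : Measurable fun v => ∫⁻ x, D v x ∂μ := hD.lintegral_prod_right'
  have hlaw : P.map (fun ω => G (u ω) + η ω) = ν.withDensity fun v => ∫⁻ x, D v x ∂μ := by
    refine Measure.ext_of_lintegral _ fun f hf => ?_
    have h1 := hjoint (fun p => f p.1) (hf.comp measurable_fst)
    rw [lintegral_map' (by fun_prop) (hym.prodMk hum)] at h1
    rw [lintegral_map' hf.aemeasurable hym, h1,
      lintegral_withDensity_eq_lintegral_mul _ hZm hf]
    refine lintegral_congr fun v => ?_
    have hDv : Measurable fun x => D v x := by fun_prop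
    rw [Pi.mul_apply, ← lintegral_mul_const _ hDv]
  refine ⟨hym.prodMk hum, Measure.ext_of_lintegral _ fun f hf => ?_⟩
  have hsf : SFinite (P.map fun ω => G (u ω) + η ω) := by rw [hlaw]; infer_instance
  rw [hjoint f hf, Measure.lintegral_compProd hf, hlaw,
    lintegral_withDensity_eq_lintegral_mul _ hZm hf.lintegral_kernel_prod_right']
  refine lintegral_congr fun v => ?_
  have hfv : Measurable fun x => f (v, x) := by fun_prop
  have hDv : Measurable fun x => D v x := by fun_prop
  rw [Pi.mul_apply, hκ v, lintegral_withDensity_eq_lintegral_mul _ (hDv.div_const _) hfv,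
    ← lintegral_const_mul _ (by fun_prop)]
  refine lintegral_congr fun x => ?_
  rw [Pi.mul_apply, ← mul_assoc, ENNReal.mul_div_cancel (hZ0 v) (hZ v)]

end LaplaceInverse

/-! ### The posterior distribution -/

open LaplaceInverse in
theorem mainTheorem10 {X : Type*} [NormedAddCommGroup X] [InnerProductSpace ℝ X] [CompleteSpace X]
    [MeasurableSpace X] [BorelSpace X]
    (φ : HilbertBasis ℕ ℝ X)
    (α : ℕ → ℝ) (hα_pos : ∀ k, 0 < α k) (hα_mono : Monotone α)
    (d Cm Cp : ℝ) (hd : 0 < d) (hCm : 0 < Cm)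
    (hα_lower : ∀ k : ℕ, Cm * ((k : ℝ) + 1) ^ (2 / d) ≤ α k)
    (hα_upper : ∀ k : ℕ, α k ≤ Cp * ((k : ℝ) + 1) ^ (2 / d))
    (b r β τ : ℝ) (hb : 0 < b) (hr : 0 < r) (hβ : d / 2 < β) (hτ : d / 2 < τ)
    (μ₀ ν : Measure X)
    (hμ₀ : μ₀ = gaussianMeasure φ (fun k => (r ^ 2 * α k ^ (-τ)).toNNReal))
    (hν : ν = laplaceMeasure φ (fun k => (b ^ 2 * α k ^ (-β)).toNNReal))
    {Ω : Type*} [MeasurableSpace Ω] (P : Measure Ω) [IsProbabilityMeasure P]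
    (u η y : Ω → X) (hu : HasLaw u μ₀ P) (hη : HasLaw η ν P) (hind : IndepFun u η P)
    (hy : ∀ ω, y ω = diagOp φ (fun k => Real.exp (-α k)) (u ω) + η ω) :
    (∀ x v : X, Summable (phiTerm φ α b β x v)) ∧
    (∀ v : X, Integrable (fun x => Real.exp (-phi φ α b β x v)) μ₀) ∧
    (∃ C : ℝ, 0 < C ∧ ∀ v : X, C ≤ ∫ x, Real.exp (-phi φ α b β x v) ∂μ₀) ∧
    ∃ κ : Kernel X X, IsMarkovKernel κ ∧ HasCondDistrib u y κ P ∧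
      ∀ v : X, κ v ≪ μ₀ ∧
        κ v = μ₀.withDensity (fun x => ENNReal.ofReal
          (Real.exp (-phi φ α b β x v) / ∫ x', Real.exp (-phi φ α b β x' v) ∂μ₀)) := by
  have := secondCountableTopology_of_hilbertBasis φ
  have hsum := summable_rpow_mul_exp_neg hd hCm hα_lower (β / 2)
  have hgauss : IsGaussian μ₀ := hμ₀ ▸ isGaussian_gaussianMeasure φ _
    ((summable_rpow_neg hd hCm hα_lower hτ).mul_left (r ^ 2)).toNNReal
  have hνprob : IsProbabilityMeasure ν := hν ▸ inferInstance
  obtain ⟨c, hc⟩ := exists_abs_phi_le φ hα_pos hb hsum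
  have hmeas : Measurable fun p : X × X => Real.exp (-phi φ α b β p.2 p.1) :=
    (measurable_phi φ α b β).neg.exp
  have hint : ∀ v : X, Integrable (fun x => Real.exp (-phi φ α b β x v)) μ₀ := by
    intro v
    refine (IsGaussian.integrable_exp_mul_norm μ₀ c).mono'
      (hmeas.comp measurable_prodMk_left).aestronglyMeasurable (ae_of_all _ fun x => ?_)
    rw [Real.norm_of_nonneg (Real.exp_pos _).le, Real.exp_le_exp]
    exact (neg_le_abs _).trans (hc x v)
  have hpos : ∀ v : X, 0 < ∫ x, Real.exp (-phi φ α b β x v) ∂μ₀ := fun v =>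
    integral_exp_pos (hint v)
  refine ⟨summable_phiTerm φ hα_pos hb hsum, hint,
    ⟨∫ x, Real.exp (-c * ‖x‖) ∂μ₀, integral_exp_pos (IsGaussian.integrable_exp_mul_norm μ₀ _),
      fun v => integral_mono (IsGaussian.integrable_exp_mul_norm μ₀ _) (hint v) fun x => ?_⟩, ?_⟩
  · simp only [Real.exp_le_exp]
    linarith [le_abs_self (phi φ α b β x v), hc x v]
  have hZeq : ∀ v : X, ∫⁻ x, ENNReal.ofReal (Real.exp (-phi φ α b β x v)) ∂μ₀
      = ENNReal.ofReal (∫ x, Real.exp (-phi φ α b β x v) ∂μ₀) := fun v =>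
    (ofReal_integral_eq_lintegral_ofReal (hint v) (ae_of_all _ fun x => (Real.exp_pos _).le)).symm
  have hdens : Measurable (Function.uncurry fun v x => ENNReal.ofReal
      (Real.exp (-phi φ α b β x v) / ∫ x', Real.exp (-phi φ α b β x' v) ∂μ₀)) := by
    have hZm : Measurable fun v => ∫ x, Real.exp (-phi φ α b β x v) ∂μ₀ :=
      hmeas.stronglyMeasurable.integral_prod_right'.measurable
    exact (hmeas.div (hZm.comp measurable_fst)).ennreal_ofReal
  set κ : Kernel X X := (Kernel.const X μ₀).withDensity fun v x => ENNReal.ofReal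
    (Real.exp (-phi φ α b β x v) / ∫ x', Real.exp (-phi φ α b β x' v) ∂μ₀) with hκdef
  have hκ : ∀ v, κ v = μ₀.withDensity fun x => ENNReal.ofReal
      (Real.exp (-phi φ α b β x v) / ∫ x', Real.exp (-phi φ α b β x' v) ∂μ₀) := fun v => by
    rw [hκdef, Kernel.withDensity_apply _ hdens, Kernel.const_apply]
  have hmarkov : IsMarkovKernel κ := by
    refine ⟨fun v => ⟨?_⟩⟩
    rw [hκ, withDensity_apply _ MeasurableSet.univ, Measure.restrict_univ,
      ← ofReal_integral_eq_lintegral_ofReal ((hint v).div_const _)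
        (ae_of_all _ fun x => div_nonneg (Real.exp_pos _).le (hpos v).le),
      integral_div, div_self (hpos v).ne', ENNReal.ofReal_one]
  refine ⟨κ, hmarkov, ?_, fun v => ⟨hκ v ▸ withDensity_absolutelyContinuous _ _, hκ v⟩⟩
  rw [show y = fun ω => diagOp φ (fun k => Real.exp (-α k)) (u ω) + η ω from funext hy]
  refine hasCondDistrib_of_map_eq_withDensity
    (D := fun v x => ENNReal.ofReal (Real.exp (-phi φ α b β x v)))
    (measurable_diagOp φ _) hmeas.ennreal_ofReal (fun x => ?_) (fun v => ?_) (fun v => ?_)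
    hu hη hind fun v => ?_
  · rw [hν]
    exact laplaceMeasure_map_diagOp_add φ hα_pos hb (summable_rpow_neg hd hCm hα_lower hβ) hsum x
  · rw [hZeq]
    exact (ENNReal.ofReal_pos.2 (hpos v)).ne'
  · rw [hZeq]
    exact ENNReal.ofReal_ne_top
  · rw [hκ, hZeq]
    simp only [ENNReal.ofReal_div_of_pos (hpos v)]
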